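/- Let $BW\in\mathbb R$ (the bandwidth), $m_1,m_2>0$ and $\Omega>0$. For $j=1,2$ let $N_j$ be a Nakagami coefficient, i.e. $N_j^2$ has density $\frac{m_j^{m_j}x^{m_j-1}}{\Omega^{m_j}\Gamma(m_j)}e^{-m_jx/\Omega}$ on $x>0$. An inverse-gamma variable with shape $\alpha$ and scale $\beta$ has density $\frac{\beta^{\alpha}}{\Gamma(\alpha)y^{\alpha+1}}e^{-\beta/y}$ on $y>0$. The ergodic capacity of a channel with random received SNR $\gamma$ is $\bar C=BW\cdot\mathbb E[\log_2(1+\gamma)]$. Meijer's G-function is $$G^{m,n}_{p,q}\Big(z\,\Big|\,{a_1,\dots,a_p\atop b_1,\dots,b_q}\Big)=\frac1{2\pi i}\int_{\sigma-i\infty}^{\sigma+i\infty}\frac{\prod_{j=1}^m\Gamma(b_j-s)\prod_{j=1}^n\Gamma(1-a_j+s)}{\prod_{j=m+1}^q\Gamma(1-b_j+s)\prod_{j=n+1}^p\Gamma(a_j-s)}\,z^s\,ds,$$ where the line $\mathrm{Re}\,s=\sigma$ separates the poles of the $\Gamma(b_j-s)$, $j\le m$ (on its right), from those of the $\Gamma(1-a_j+s)$,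 $j\le n$ (on its left). (Double shadowing.) Let $\gamma=(N_1^2I_1)(N_2^2I_2)$, where $I_j$ is inverse-gamma with shape $\alpha_j>1$ and scale $\bar\gamma_j>0$, $N_j^2$ is independent of $I_j$ for $j=1,2$, and $N_1^2I_1$ is independent of $N_2^2I_2$. Put $\bar\gamma=\Omega^2\bar\gamma_1\bar\gamma_2$, $\tilde\gamma=m_1m_2/\bar\gamma$ and $\mathcal S_1=\frac1{\Gamma(m_1)\Gamma(m_2)\Gamma(\alpha_1)\Gamma(\alpha_2)}$. Then $\log_2(1+\gamma)$ is integrable and $$\bar C=BW\,\mathcal S_1\,(\ln 2)^{-1}\,G^{4,3}_{4,4}\Big(\tilde\gamma\,\Big|\,{1-\alpha_2,\,1-\alpha_1,\,0,\,1\atop m_1,\,m_2,\,0,\,0}\Big).$$ (Single shadowing.) Let $\gamma=(N_1N_2)^2I$, where $I$ is inverse-gamma with shape $\alpha>1$ and scale $\beta>0$, $N_1^2$ and $N_2^2$ are independent, and $(N_1N_2)^2$ is independent of $I$. Put $\bar\gamma=\Omega^2\beta$, $\tilde\gamma=m_1m_2/\bar\gamma$ and $\mathcal S_2=\frac1{\Gamma(m_1)\Gamma(m_2)\Gamma(\alpha)}$.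 Then $\log_2(1+\gamma)$ is integrable and $$\bar C=BW\,\mathcal S_2\,(\ln 2)^{-1}\,G^{4,2}_{3,4}\Big(\tilde\gamma\,\Big|\,{1-\alpha,\,0,\,1\atop m_1,\,m_2,\,0,\,0}\Big).$$ In both cases a separating line exists, and the integral defining the G-function converges absolutely along every separating line, with a value that does not depend on the line. -/

import Mathlib

open MeasureTheory ProbabilityTheory

noncomputable section

namespace ShadowedDoubleScattering

/-! ### Meijer's G-function -/

/-- The integrand of the Mellin-Barnes integral of `G^{m,n}_{p,q}(z | a; b)`:
`∏_{j ≤ m} Γ(b_j - s) ∏_{j ≤ n} Γ(1 - a_j + s) /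
  (∏_{j > m} Γ(1 - b_j + s) ∏_{j > n} Γ(a_j - s)) * z ^ s`.
Indices start at `0` here, so `j ≤ m` reads `j < m`. At a pole of a gamma factor in the
denominator Mathlib's conventions give `1 / Γ = 0`, which is the value of the entire
function `1 / Γ` there. -/
def meijerGIntegrand {p q : ℕ} (m n : ℕ) (a : Fin p → ℂ) (b : Fin q → ℂ) (z s : ℂ) : ℂ :=
  ((∏ j : Fin q, if (j : ℕ) < m then Complex.Gamma (b j - s) else 1) *
      (∏ j : Fin p, if (j : ℕ) < n then Complex.Gamma (1 - a j + s) else 1)) /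
    ((∏ j : Fin q, if (j : ℕ) < m then 1 else Complex.Gamma (1 - b j + s)) *
      (∏ j : Fin p, if (j : ℕ) < n then 1 else Complex.Gamma (a j - s))) * z ^ s

/-- The line `Re s = σ` separates the poles `b_j + k` (`j ≤ m`, `k ∈ ℕ`) of the factors
`Γ(b_j - s)`, on its right, from the poles `a_j - 1 - k` (`j ≤ n`, `k ∈ ℕ`) of the factors
`Γ(1 - a_j + s)`, on its left. -/
def SeparatesPoles {p q : ℕ} (m n : ℕ) (a : Fin p → ℂ) (b : Fin q → ℂ) (σ : ℝ) : Prop :=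
  (∀ j : Fin q, (j : ℕ) < m → σ < (b j).re) ∧ (∀ j : Fin p, (j : ℕ) < n → (a j).re - 1 < σ)

/-- The Mellin-Barnes integral `(2πi)⁻¹ ∫ …` along the upward line `Re s = σ`; the factor
`i` of `ds = i dt` cancels that of `2πi`. -/
def meijerGLine {p q : ℕ} (m n : ℕ) (a : Fin p → ℂ) (b : Fin q → ℂ) (z : ℂ) (σ : ℝ) : ℂ :=
  (2 * (Real.pi : ℂ))⁻¹ * ∫ t : ℝ, meijerGIntegrand m n a b z ((σ : ℂ) + (t : ℂ) * Complex.I)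

open Classical in
/-- Meijer's G-function `G^{m,n}_{p,q}(z | a; b)`, as the Mellin-Barnes integral along a
vertical line that separates the two families of poles (`0` by convention if there is no
such line). See `MeijerGWellDefined` for its independence of the line. -/
def meijerG {p q : ℕ} (m n : ℕ) (a : Fin p → ℂ) (b : Fin q → ℂ) (z : ℂ) : ℂ :=
  if h : ∃ σ : ℝ, SeparatesPoles m n a b σ then meijerGLine m n a b z h.choose else 0

/-- The Mellin-Barnes definition of `G^{m,n}_{p,q}(z | a; b)` makes sense: a separating line
exists, and along every separating line the integral converges absolutely and has the value
`meijerG m n a b z`. -/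
def MeijerGWellDefined {p q : ℕ} (m n : ℕ) (a : Fin p → ℂ) (b : Fin q → ℂ) (z : ℂ) : Prop :=
  (∃ σ : ℝ, SeparatesPoles m n a b σ) ∧
    ∀ σ : ℝ, SeparatesPoles m n a b σ →
      Integrable (fun t : ℝ => meijerGIntegrand m n a b z ((σ : ℂ) + (t : ℂ) * Complex.I)) ∧
        meijerGLine m n a b z σ = meijerG m n a b z

/-! ### The channel model -/

/-- The law of the square of a Nakagami-`m` variable with mean square `Ω`: its density is
`m ^ m x ^ (m - 1) / (Ω ^ m Γ(m)) * exp (- m x / Ω)` on `x > 0`, that is, the gamma law of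
shape `m` and rate `m / Ω`. -/
def nakagamiSqMeasure (m Ω : ℝ) : Measure ℝ := gammaMeasure m (m / Ω)

/-- The density of the inverse-gamma law with shape `α` and scale `β`. -/
def invGammaPDFReal (α β y : ℝ) : ℝ :=
  if 0 < y then β ^ α / (Real.Gamma α * y ^ (α + 1)) * Real.exp (-(β / y)) else 0

/-- The inverse-gamma law with shape `α` and scale `β`. -/
def invGammaMeasure (α β : ℝ) : Measure ℝ :=
  volume.withDensity fun y => ENNReal.ofReal (invGammaPDFReal α β y)

/-- The ingredients of the double-shadowing channel: Nakagami fading coefficients `N₁`, `N₂`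
and inverse-gamma shadowing coefficients `I₁`, `I₂`; fading and shadowing are independent
within each scattering region, and the SNR factors of the two regions are independent. -/
structure IsDoubleShadowing {S : Type*} [MeasurableSpace S] (P : Measure S)
    (N₁ N₂ I₁ I₂ : S → ℝ) (m₁ m₂ Ω α₁ α₂ β₁ β₂ : ℝ) : Prop where
  law_N₁ : HasLaw (fun ω => N₁ ω ^ 2) (nakagamiSqMeasure m₁ Ω) P
  law_N₂ : HasLaw (fun ω => N₂ ω ^ 2) (nakagamiSqMeasure m₂ Ω) P
  law_I₁ : HasLaw I₁ (invGammaMeasure α₁ β₁) P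
  law_I₂ : HasLaw I₂ (invGammaMeasure α₂ β₂) P
  indep₁ : IndepFun (fun ω => N₁ ω ^ 2) I₁ P
  indep₂ : IndepFun (fun ω => N₂ ω ^ 2) I₂ P
  indep : IndepFun (fun ω => N₁ ω ^ 2 * I₁ ω) (fun ω => N₂ ω ^ 2 * I₂ ω) P

/-- The ingredients of the single-shadowing channel: Nakagami fading coefficients `N₁`, `N₂`
with independent squares, and one inverse-gamma shadowing coefficient `I`, independent of the
double-scattering factor `(N₁ N₂) ^ 2`. -/
structure IsSingleShadowing {S : Type*} [MeasurableSpace S] (P : Measure S)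
    (N₁ N₂ I : S → ℝ) (m₁ m₂ Ω α β : ℝ) : Prop where
  law_N₁ : HasLaw (fun ω => N₁ ω ^ 2) (nakagamiSqMeasure m₁ Ω) P
  law_N₂ : HasLaw (fun ω => N₂ ω ^ 2) (nakagamiSqMeasure m₂ Ω) P
  law_I : HasLaw I (invGammaMeasure α β) P
  indep_N : IndepFun (fun ω => N₁ ω ^ 2) (fun ω => N₂ ω ^ 2) P
  indep : IndepFun (fun ω => (N₁ ω * N₂ ω) ^ 2) I P

/-- The received SNR of the double-shadowing channel. -/
def snrDS {S : Type*} (N₁ N₂ I₁ I₂ : S → ℝ) (ω : S) : ℝ :=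
  (N₁ ω ^ 2 * I₁ ω) * (N₂ ω ^ 2 * I₂ ω)

/-- The received SNR of the single-shadowing channel. -/
def snrSS {S : Type*} (N₁ N₂ I : S → ℝ) (ω : S) : ℝ :=
  (N₁ ω * N₂ ω) ^ 2 * I ω

/-- The ergodic capacity `BW * E[log₂ (1 + γ)]`. -/
def ergodicCapacity {S : Type*} [MeasurableSpace S] (P : Measure S) (BW : ℝ) (γ : S → ℝ) : ℝ :=
  BW * ∫ ω, Real.logb 2 (1 + γ ω) ∂P

/-- The normalising constant `1 / (Γ(m₁) Γ(m₂) Γ(α₁) Γ(α₂))`. -/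
def constDS (m₁ m₂ α₁ α₂ : ℝ) : ℝ :=
  1 / (Real.Gamma m₁ * Real.Gamma m₂ * Real.Gamma α₁ * Real.Gamma α₂)

/-- The normalising constant `1 / (Γ(m₁) Γ(m₂) Γ(α))`. -/
def constSS (m₁ m₂ α : ℝ) : ℝ :=
  1 / (Real.Gamma m₁ * Real.Gamma m₂ * Real.Gamma α)

end ShadowedDoubleScattering

end

namespace ShadowedDoubleScattering
open Filter Topology Set Asymptotics

/-! On the strip `-1 < Re s < 0` the Mellin transform of `log (1 + x)` is `Γ(-s) Γ(1 + s) / (-s)`,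
and Mellin inversion writes `log (1 + x)` as a vertical-line integral of this kernel times `x ^
(-s)`. Putting `x = γ`, taking expectations and exchanging integrals (Fubini) leaves the kernel
times `E[γ ^ (-s)]`. By independence this moment is a product: each gamma law gives `Γ(m - s) /
Γ(m)`, each inverse-gamma law `Γ(α + s) / Γ(α)`, and the scale factors combine into `γtilde ^ s`.
Since `Γ(1 - s) = -s Γ(-s)`, the result is the Mellin-Barnes integrand up to the normalising
constant.

The separating lines are exactly those with `-1 < σ < 0`. The argument runs on each of them and
always yields the same expectation, so independence of the line needs no contour shift. The analysis
is in `mellin_log_one_add` and `integrable_gamma_kernel`, the exchange in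
`HasMellinMoment.log_one_add`, the assembly in `HasMellinMoment.capacity`. -/

/-! ### Mellin transforms of `(1 + x)⁻¹` and `log (1 + x)`. -/

theorem integrableOn_rpow_div_one_add {c : ℝ} (h0 : 0 < c) (h1 : c < 1) :
    IntegrableOn (fun x : ℝ => x ^ (c - 1) * (1 + x)⁻¹) (Ioi 0) := by
  have hcont : ContinuousOn (fun x : ℝ => (1 + x)⁻¹) (Ioi 0) :=
    ContinuousOn.inv₀ (by fun_prop) fun x (hx : 0 < x) => by positivity
  refine mellin_convergent_of_isBigO_scalar (a := 1) (b := 0)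
    (hcont.locallyIntegrableOn measurableSet_Ioi) ?_ h1 ?_ h0
  · refine IsBigO.of_bound 1 ?_
    filter_upwards [eventually_gt_atTop 0] with x hx
    rw [Real.rpow_neg_one, one_mul, Real.norm_of_nonneg (by positivity),
      Real.norm_of_nonneg (by positivity)]
    exact inv_anti₀ hx (by linarith)
  · refine IsBigO.of_bound 1 ?_
    filter_upwards [self_mem_nhdsWithin] with x hx
    have hx' : 0 < x := hx
    rw [neg_zero, Real.rpow_zero, norm_one, one_mul, Real.norm_of_nonneg (by positivity)]
    exact inv_le_one_of_one_le₀ (by linarith)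

theorem integral_exp_neg_mul_Ioi_zero {r : ℝ} (hr : 0 < r) :
    ∫ t in Ioi (0 : ℝ), Real.exp (-(r * t)) = r⁻¹ := by
  have := integral_exp_mul_Ioi (a := -r) (by linarith) 0
  simpa [neg_div, div_neg] using this

theorem integrableOn_exp_neg_mul_Ioi_zero {r : ℝ} (hr : 0 < r) :
    IntegrableOn (fun t : ℝ => Real.exp (-(r * t))) (Ioi 0) := by
  simpa using integrableOn_exp_mul_Ioi (a := -r) (by linarith) 0

/-- The Mellin transform of `x ↦ (1 + x)⁻¹`. -/
theorem integral_cpow_div_one_add {s : ℂ} (h0 : 0 < s.re) (h1 : s.re < 1) :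
    ∫ x in Ioi (0 : ℝ), (x : ℂ) ^ (s - 1) * ((1 + x : ℝ) : ℂ)⁻¹ =
      Complex.Gamma s * Complex.Gamma (1 - s) := by
  -- With `(1 + x)⁻¹ = ∫ exp (-(1 + x) t) dt` and the integrals exchanged, the `x`-integral is `Γ(s)
  -- t ^ (-s)` and the remaining `t`-integral is `Γ(1 - s)`.
  have hint : Integrable
      (Function.uncurry fun x t : ℝ => (x : ℂ) ^ (s - 1) * (Real.exp (-((1 + x) * t)) : ℂ))
      ((volume.restrict (Ioi 0)).prod (volume.restrict (Ioi 0))) := by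
    have hm : Measurable
        (Function.uncurry fun x t : ℝ => (x : ℂ) ^ (s - 1) * (Real.exp (-((1 + x) * t)) : ℂ)) := by
      unfold Function.uncurry
      fun_prop
    rw [integrable_prod_iff hm.aestronglyMeasurable]
    constructor
    · filter_upwards [ae_restrict_mem measurableSet_Ioi] with x hx
      have hx' : (0 : ℝ) < x := hx
      have h := integrableOn_exp_neg_mul_Ioi_zero (by linarith : 0 < 1 + x)
      exact (Integrable.ofReal (𝕜 := ℂ) h).const_mul ((x : ℂ) ^ (s - 1))
    · refine (integrableOn_rpow_div_one_add h0 h1).congr ?_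
      filter_upwards [ae_restrict_mem measurableSet_Ioi] with x hx
      have hx' : (0 : ℝ) < x := hx
      simp only [Function.uncurry, norm_mul, Complex.norm_cpow_eq_rpow_re_of_pos hx',
        Complex.norm_real, Real.norm_eq_abs, Real.abs_exp]
      rw [integral_const_mul, integral_exp_neg_mul_Ioi_zero (by linarith)]
      simp
  calc
    _ = ∫ x in Ioi (0 : ℝ), ∫ t in Ioi (0 : ℝ),
          (x : ℂ) ^ (s - 1) * (Real.exp (-((1 + x) * t)) : ℂ) := by
      refine setIntegral_congr_fun measurableSet_Ioi fun x hx => ?_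
      have hx' : (0 : ℝ) < x := hx
      rw [integral_const_mul, integral_complex_ofReal,
        integral_exp_neg_mul_Ioi_zero (by linarith), Complex.ofReal_inv]
    _ = ∫ t in Ioi (0 : ℝ), ∫ x in Ioi (0 : ℝ),
          (x : ℂ) ^ (s - 1) * (Real.exp (-((1 + x) * t)) : ℂ) := integral_integral_swap hint
    _ = ∫ t in Ioi (0 : ℝ), Complex.Gamma s * ((Real.exp (-t) : ℂ) * (t : ℂ) ^ (1 - s - 1)) := by
      refine setIntegral_congr_fun measurableSet_Ioi fun t ht => ?_
      have ht' : (0 : ℝ) < t := ht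
      have e : ∀ x : ℝ, (x : ℂ) ^ (s - 1) * (Real.exp (-((1 + x) * t)) : ℂ) =
          (Real.exp (-t) : ℂ) * ((x : ℂ) ^ (s - 1) * Complex.exp (-(t * x))) := fun x => by
        rw [show -((1 + x) * t) = -t + -(t * x) by ring, Real.exp_add]
        push_cast
        ring
      simp only [e]
      rw [integral_const_mul, Complex.integral_cpow_mul_exp_neg_mul_Ioi h0 ht', one_div,
        Complex.inv_cpow _ _ (by rw [Complex.arg_ofReal_of_nonneg ht'.le]; exact Real.pi_pos.ne),
        ← Complex.cpow_neg]
      ring_nf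
    _ = _ := by
      rw [integral_const_mul, Complex.Gamma_eq_integral (s := 1 - s) (by simpa using h1), Complex.GammaIntegral]

theorem log_one_add_isBigO_atTop {ε : ℝ} (hε : 0 < ε) :
    (fun x : ℝ => Real.log (1 + x)) =O[atTop] fun x => x ^ ε := by
  have h1 : (fun x : ℝ => Real.log (1 + x)) =O[atTop] fun x => (1 + x) ^ ε :=
    (isLittleO_log_rpow_atTop hε).isBigO.comp_tendsto (tendsto_atTop_add_const_left _ 1 tendsto_id)
  refine h1.trans (IsBigO.of_bound (2 ^ ε) ?_)
  filter_upwards [eventually_ge_atTop 1] with x hx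
  rw [Real.norm_of_nonneg (by positivity), Real.norm_of_nonneg (by positivity),
    ← Real.mul_rpow (by norm_num) (by linarith)]
  exact Real.rpow_le_rpow (by linarith) (by linarith) hε.le

theorem log_one_add_isBigO_zero :
    (fun x : ℝ => Real.log (1 + x)) =O[𝓝[>] 0] fun x => x := by
  refine IsBigO.of_bound 1 ?_
  filter_upwards [self_mem_nhdsWithin] with x hx
  have hx' : (0 : ℝ) < x := hx
  rw [Real.norm_of_nonneg (Real.log_nonneg (by linarith)), Real.norm_of_nonneg hx'.le, one_mul]
  linarith [Real.log_le_sub_one_of_pos (by linarith : 0 < 1 + x)]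

theorem mellinConvergent_log_one_add {s : ℂ} (h1 : -1 < s.re) (h0 : s.re < 0) :
    MellinConvergent (fun x : ℝ => (Real.log (1 + x) : ℂ)) s := by
  -- Any `a` strictly between `Re s` and `0` would serve, as the logarithm grows slower than every
  -- positive power; `b = -1` records the linear vanishing at `0`.
  refine mellinConvergent_of_isBigO_rpow (a := s.re / 2) (b := -1) ?_ ?_ (by linarith) ?_ h1
  · refine ContinuousOn.locallyIntegrableOn ?_ measurableSet_Ioi
    refine Complex.continuous_ofReal.comp_continuousOn (ContinuousOn.log (by fun_prop) ?_)
    intro x (hx : 0 < x)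
    positivity
  · refine (isBigO_norm_left.mp ?_)
    simpa using (log_one_add_isBigO_atTop (by linarith : 0 < -(s.re / 2)))
  · refine (isBigO_norm_left.mp ?_)
    simpa using log_one_add_isBigO_zero

/-- Integration by parts against `x ^ s / s` reduces to the transform of `(1 + x)⁻¹` at `1 + s`. The
boundary terms vanish at `0` because `Re s > -1` and at infinity because `Re s < 0`. -/
theorem mellin_log_one_add {s : ℂ} (h1 : -1 < s.re) (h0 : s.re < 0) :
    mellin (fun x : ℝ => (Real.log (1 + x) : ℂ)) s =
      Complex.Gamma (-s) * Complex.Gamma (1 + s) / (-s) := by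
  have hs : s ≠ 0 := by rintro rfl; simp at h0
  have hbeta := integral_cpow_div_one_add (s := 1 + s) (by simpa using by linarith)
    (by simpa using h0)
  have hbeta_int : IntegrableOn (fun x : ℝ => (x : ℂ) ^ s * ((1 + x : ℝ) : ℂ)⁻¹) (Ioi 0) := by
    have := integrableOn_rpow_div_one_add (c := 1 + s.re) (by linarith) (by linarith)
    refine this.mono' (Measurable.aestronglyMeasurable (by fun_prop)) ?_
    filter_upwards [ae_restrict_mem measurableSet_Ioi] with x hx
    have hx' : (0 : ℝ) < x := hx
    rw [norm_mul, Complex.norm_cpow_eq_rpow_re_of_pos hx', norm_inv, Complex.norm_real,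
      Real.norm_of_nonneg (by linarith), add_sub_cancel_left]
  have hnorm : ∀ x : ℝ, 0 < x →
      ‖(Real.log (1 + x) : ℂ) * ((x : ℂ) ^ s / s)‖ = ‖s‖⁻¹ * (Real.log (1 + x) * x ^ s.re) :=
    fun x hx => by
      rw [norm_mul, norm_div, Complex.norm_cpow_eq_rpow_re_of_pos hx, Complex.norm_real,
        Real.norm_of_nonneg (Real.log_nonneg (by linarith))]
      ring
  have key := integral_Ioi_mul_deriv_eq_deriv_mul (a := 0) (a' := 0) (b' := 0)
    (u := fun x : ℝ => (Real.log (1 + x) : ℂ)) (u' := fun x => ((1 + x : ℝ) : ℂ)⁻¹)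
    (v := fun x : ℝ => (x : ℂ) ^ s / s) (v' := fun x : ℝ => (x : ℂ) ^ (s - 1))
    (fun x (hx : 0 < x) => by
      have : HasDerivAt (fun x : ℝ => Real.log (1 + x)) ((1 + x)⁻¹) x := by
        simpa using ((hasDerivAt_id x).const_add 1).log (by simp; linarith)
      simpa using this.ofReal_comp)
    (fun x (hx : 0 < x) => by
      have := hasDerivAt_ofReal_cpow_const' hx.ne' (r := s - 1)
        fun h => hs (by linear_combination h)
      simpa using this)
    (by simpa [MellinConvergent, mul_comm, Pi.mul_def] using mellinConvergent_log_one_add h1 h0)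
    (by
      have := hbeta_int.div_const s
      refine this.congr (Eventually.of_forall fun x => ?_)
      simp only [Pi.mul_apply]
      ring)
    (by
      rw [tendsto_zero_iff_norm_tendsto_zero]
      have h : Tendsto (fun x : ℝ => ‖s‖⁻¹ * (Real.log (1 + x) * x ^ s.re)) (𝓝[>] 0) (𝓝 0) := by
        suffices Tendsto (fun x : ℝ => Real.log (1 + x) * x ^ s.re) (𝓝[>] 0) (𝓝 0) by
          simpa using this.const_mul ‖s‖⁻¹
        refine (log_one_add_isBigO_zero.mul (isBigO_refl (fun x : ℝ => x ^ s.re) _)).trans_tendsto ?_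
        have : Tendsto (fun x : ℝ => x ^ (1 + s.re)) (𝓝[>] 0) (𝓝 0) := by
          have := (Real.continuousAt_rpow_const 0 (1 + s.re) (Or.inr (by linarith))).tendsto
          rw [Real.zero_rpow (by linarith)] at this
          exact this.mono_left nhdsWithin_le_nhds
        refine this.congr' ?_
        filter_upwards [self_mem_nhdsWithin] with x hx
        rw [Real.rpow_add hx, Real.rpow_one]
      refine h.congr' ?_
      filter_upwards [self_mem_nhdsWithin] with x hx
      exact (hnorm x hx).symm)
    (by
      rw [tendsto_zero_iff_norm_tendsto_zero]
      have h : Tendsto (fun x : ℝ => ‖s‖⁻¹ * (Real.log (1 + x) * x ^ s.re)) atTop (𝓝 0) := by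
        rw [← mul_zero ‖s‖⁻¹]
        refine Tendsto.const_mul _ ?_
        refine ((log_one_add_isBigO_atTop (by linarith : 0 < -(s.re / 2))).mul
          (isBigO_refl (fun x : ℝ => x ^ s.re) _)).trans_tendsto ?_
        refine (tendsto_rpow_neg_atTop (by linarith : 0 < -(s.re / 2))).congr' ?_
        filter_upwards [eventually_gt_atTop 0] with x hx
        rw [← Real.rpow_add hx]
        ring_nf
      refine h.congr' ?_
      filter_upwards [eventually_gt_atTop 0] with x hx
      exact (hnorm x hx).symm)
  calc
    _ = ∫ x in Ioi (0 : ℝ), (Real.log (1 + x) : ℂ) * (x : ℂ) ^ (s - 1) := by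
      simp only [mellin, smul_eq_mul, mul_comm]
    _ = -∫ x in Ioi (0 : ℝ), ((1 + x : ℝ) : ℂ)⁻¹ * ((x : ℂ) ^ s / s) := by simpa using key
    _ = -((∫ x in Ioi (0 : ℝ), (x : ℂ) ^ (1 + s - 1) * ((1 + x : ℝ) : ℂ)⁻¹) / s) := by
      rw [← integral_div]
      congr 2 with x
      rw [add_sub_cancel_left]
      ring
    _ = _ := by
      rw [hbeta, show 1 - (1 + s) = -s by ring, div_neg, mul_comm]

/-! ### Decay of the kernel and Mellin inversion. -/

theorem norm_sq_sin (x y : ℝ) :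
    ‖Complex.sin (x + y * Complex.I)‖ ^ 2 = Real.sin x ^ 2 + Real.sinh y ^ 2 := by
  rw [Complex.sin_add_mul_I, ← Complex.ofReal_sin, ← Complex.ofReal_cos, ← Complex.ofReal_sinh,
    ← Complex.ofReal_cosh, Complex.sq_norm, ← Complex.ofReal_mul, ← Complex.ofReal_mul,
    Complex.normSq_add_mul_I]
  nlinarith [Real.cosh_sq y, Real.sin_sq_add_cos_sq x]

/-- The reflection formula makes the kernel elementary, so its decay can be read off the sine,
without Stirling's formula. -/
theorem Gamma_neg_mul_Gamma_one_add_div (s : ℂ) :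
    Complex.Gamma (-s) * Complex.Gamma (1 + s) / (-s) =
      Real.pi / (s * Complex.sin (Real.pi * s)) := by
  have h := Complex.Gamma_mul_Gamma_one_sub (1 + s)
  rw [show 1 - (1 + s) = -s by ring, show (Real.pi : ℂ) * (1 + s) = Real.pi * s + Real.pi by ring,
    Complex.sin_add_pi] at h
  rw [mul_comm, h, div_neg, div_neg, neg_div, neg_neg, div_div, mul_comm s]

/-- Inside the strip neither `s` nor `sin (π s)` vanishes, and both grow at least linearly in `t`;
the kernel is therefore dominated by a multiple of `(1 + t ^ 2)⁻¹`. -/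
theorem integrable_gamma_kernel {σ : ℝ} (h1 : -1 < σ) (h0 : σ < 0) :
    Integrable fun t : ℝ => Complex.Gamma (-((σ : ℂ) + t * Complex.I)) *
      Complex.Gamma (1 + ((σ : ℂ) + t * Complex.I)) / (-((σ : ℂ) + t * Complex.I)) := by
  simp only [Gamma_neg_mul_Gamma_one_add_div]
  have hsin : Real.sin (Real.pi * σ) < 0 :=
    Real.sin_neg_of_neg_of_neg_pi_lt (by nlinarith [Real.pi_pos]) (by nlinarith [Real.pi_pos])
  -- `c` lies below the values at `t = 0` of both squared norms and below the coefficient `1` of `t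
  -- ^ 2`, so each squared norm is at least `c * (1 + t ^ 2)`.
  obtain ⟨c, hc, hc1, hcσ, hcs⟩ : ∃ c : ℝ, 0 < c ∧ c ≤ 1 ∧ c ≤ σ ^ 2 ∧
      c ≤ Real.sin (Real.pi * σ) ^ 2 :=
    ⟨min 1 (min (σ ^ 2) (Real.sin (Real.pi * σ) ^ 2)), by
      have := hsin.ne
      have := h0.ne
      positivity, min_le_left _ _, (min_le_right _ _).trans (min_le_left _ _),
      (min_le_right _ _).trans (min_le_right _ _)⟩
  have hbound : ∀ t : ℝ, c * (1 + t ^ 2) ≤ ‖((σ : ℂ) + t * Complex.I) *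
      Complex.sin (Real.pi * ((σ : ℂ) + t * Complex.I))‖ := fun t => by
    have e1 : ‖((σ : ℂ) + t * Complex.I)‖ ^ 2 = σ ^ 2 + t ^ 2 := by
      rw [Complex.sq_norm, Complex.normSq_add_mul_I]
    have e2 : ‖Complex.sin (Real.pi * ((σ : ℂ) + t * Complex.I))‖ ^ 2 =
        Real.sin (Real.pi * σ) ^ 2 + Real.sinh (Real.pi * t) ^ 2 := by
      rw [← norm_sq_sin]
      push_cast
      ring_nf
    have e3 : t ^ 2 ≤ Real.sinh (Real.pi * t) ^ 2 := by
      rw [sq_le_sq, Real.abs_sinh, abs_mul, abs_of_pos Real.pi_pos]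
      refine le_trans ?_ (Real.self_le_sinh_iff.2 (by positivity))
      nlinarith [Real.pi_gt_three, abs_nonneg t]
    have f1 : c * (1 + t ^ 2) ≤ ‖((σ : ℂ) + t * Complex.I)‖ ^ 2 := by nlinarith [sq_nonneg t]
    have f2 : c * (1 + t ^ 2) ≤ ‖Complex.sin (Real.pi * ((σ : ℂ) + t * Complex.I))‖ ^ 2 := by
      nlinarith [sq_nonneg t]
    refine abs_le_of_sq_le_sq' ?_ (norm_nonneg _) |>.2
    rw [norm_mul, mul_pow ‖_‖, sq (c * (1 + t ^ 2))]
    exact mul_le_mul f1 f2 (by positivity) (by positivity)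
  have hpos : ∀ t : ℝ, 0 < c * (1 + t ^ 2) := fun t => by positivity
  refine (integrable_inv_one_add_sq.const_mul (Real.pi * c⁻¹)).mono' ?_ ?_
  · refine Continuous.aestronglyMeasurable (Continuous.div (by fun_prop) (by fun_prop) fun t => ?_)
    exact norm_pos_iff.1 ((hpos t).trans_le (hbound t))
  · refine Eventually.of_forall fun t => ?_
    rw [norm_div, Complex.norm_real, Real.norm_of_nonneg Real.pi_pos.le, mul_assoc, ← mul_inv,
      div_eq_mul_inv]
    exact mul_le_mul_of_nonneg_left (inv_anti₀ (hpos t) (hbound t)) Real.pi_pos.le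

/-- The Mellin-Barnes representation of `log (1 + x)`. -/
theorem integral_gamma_kernel_mul_cpow {σ : ℝ} (h1 : -1 < σ) (h0 : σ < 0) {x : ℝ} (hx : 0 < x) :
    (2 * (Real.pi : ℂ))⁻¹ * ∫ t : ℝ, Complex.Gamma (-((σ : ℂ) + t * Complex.I)) *
      Complex.Gamma (1 + ((σ : ℂ) + t * Complex.I)) / (-((σ : ℂ) + t * Complex.I)) *
        (x : ℂ) ^ (-((σ : ℂ) + t * Complex.I)) = (Real.log (1 + x) : ℂ) := by
  have hmellin : ∀ t : ℝ, mellin (fun x : ℝ => (Real.log (1 + x) : ℂ)) ((σ : ℂ) + t * Complex.I) =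
      Complex.Gamma (-((σ : ℂ) + t * Complex.I)) *
        Complex.Gamma (1 + ((σ : ℂ) + t * Complex.I)) / (-((σ : ℂ) + t * Complex.I)) := fun t =>
    mellin_log_one_add (by simpa using h1) (by simpa using h0)
  have h := mellinInv_mellin_eq σ (fun x : ℝ => (Real.log (1 + x) : ℂ)) hx
    (mellinConvergent_log_one_add (by simpa using h1) (by simpa using h0))
    (by
      unfold Complex.VerticalIntegrable
      simp only [hmellin]
      exact integrable_gamma_kernel h1 h0)
    (Complex.continuous_ofReal.continuousAt.comp
      (ContinuousAt.log (by fun_prop) (by positivity)))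
  rw [← h]
  simp only [mellinInv, hmellin, smul_eq_mul]
  simp [mul_comm, Complex.real_smul]

/-! ### Complex moments and the exchange of expectation with the line integral. -/

/-- `X` is almost surely positive and `E[X ^ (-s)] = M s ≠ 0` for `-1 < Re s < 0`. -/
structure HasMellinMoment {S : Type*} [MeasurableSpace S] (P : Measure S) (X : S → ℝ)
    (M : ℂ → ℂ) : Prop where
  aemeasurable : AEMeasurable X P
  pos : ∀ᵐ ω ∂P, 0 < X ω
  integral_eq : ∀ s : ℂ, -1 < s.re → s.re < 0 → ∫ ω, (X ω : ℂ) ^ (-s) ∂P = M s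
  ne_zero : ∀ s : ℂ, -1 < s.re → s.re < 0 → M s ≠ 0

variable {S : Type*} [MeasurableSpace S] {P : Measure S}

/-- Almost sure positivity makes the principal power multiplicative. The product formula for
independent variables needs no integrability. -/
theorem HasMellinMoment.mul {X Y : S → ℝ} {M N : ℂ → ℂ} (hX : HasMellinMoment P X M)
    (hY : HasMellinMoment P Y N) (hXY : IndepFun X Y P) :
    HasMellinMoment P (fun ω => X ω * Y ω) (fun s => M s * N s) where
  aemeasurable := hX.aemeasurable.mul hY.aemeasurable
  pos := by
    filter_upwards [hX.pos, hY.pos] with ω h h' using mul_pos h h'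
  integral_eq s h1 h0 := by
    have hm : Measurable fun x : ℝ => (x : ℂ) ^ (-s) := by fun_prop
    rw [← hX.integral_eq s h1 h0, ← hY.integral_eq s h1 h0]
    refine Eq.trans (integral_congr_ae ?_) ((hXY.comp hm hm).integral_fun_mul_eq_mul_integral
      (hm.comp_aemeasurable hX.aemeasurable).aestronglyMeasurable
      (hm.comp_aemeasurable hY.aemeasurable).aestronglyMeasurable)
    filter_upwards [hX.pos, hY.pos] with ω h h'
    simp only [Function.comp_apply, Complex.ofReal_mul]
    exact Complex.mul_cpow_ofReal_nonneg h.le h'.le _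
  ne_zero s h1 h0 := mul_ne_zero (hX.ne_zero s h1 h0) (hY.ne_zero s h1 h0)

/-- On the line, the modulus of `X ^ (-s)` is `X ^ (-σ)`, independent of `t`, so the integrand is
dominated by a product of one-variable integrable functions. -/
theorem HasMellinMoment.integrable_prod [SFinite P] {X : S → ℝ} {M : ℂ → ℂ}
    (hX : HasMellinMoment P X M) {σ : ℝ} (h1 : -1 < σ) (h0 : σ < 0) {K : ℝ → ℂ}
    (hK : Integrable K) :
    Integrable (fun p : S × ℝ => K p.2 * (X p.1 : ℂ) ^ (-((σ : ℂ) + p.2 * Complex.I)))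
      (P.prod volume) := by
  have hXσ : Integrable (fun ω => (X ω : ℂ) ^ (-(σ : ℂ))) P := by
    -- A non-integrable function has Bochner integral `0`, so the nonvanishing of the moment already
    -- proves integrability.
    refine Integrable.of_integral_ne_zero ?_
    rw [hX.integral_eq σ (by simpa using h1) (by simpa using h0)]
    exact hX.ne_zero σ (by simpa using h1) (by simpa using h0)
  refine (hXσ.norm.mul_prod hK.norm).mono' ?_ ?_
  · refine (hK.aestronglyMeasurable.comp_snd).mul (AEMeasurable.aestronglyMeasurable ?_)
    have : AEMeasurable (fun p : S × ℝ => X p.1) (P.prod volume) := hX.aemeasurable.comp_fst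
    exact (Complex.measurable_ofReal.comp_aemeasurable this).pow
      (Measurable.aemeasurable (by fun_prop))
  · have := Measure.quasiMeasurePreserving_fst (μ := P) (ν := (volume : Measure ℝ)) |>.ae hX.pos
    filter_upwards [this] with p hp
    rw [norm_mul, Complex.norm_cpow_eq_rpow_re_of_pos hp, Complex.norm_cpow_eq_rpow_re_of_pos hp,
      mul_comm]
    simp

/-- Integrating the jointly integrable function over `t` gives `log (1 + X)` up to `2π`, and over
`ω` gives `G`; both integrabilities and the identity are then Fubini. -/
theorem HasMellinMoment.log_one_add [SFinite P] {X : S → ℝ} {M : ℂ → ℂ}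
    (hX : HasMellinMoment P X M) {σ : ℝ} (h1 : -1 < σ) (h0 : σ < 0) {G : ℂ → ℂ}
    (hG : ∀ s : ℂ, s.re = σ →
      G s = Complex.Gamma (-s) * Complex.Gamma (1 + s) / (-s) * M s) :
    Integrable (fun ω => Real.log (1 + X ω)) P ∧
      Integrable (fun t : ℝ => G ((σ : ℂ) + t * Complex.I)) ∧
      (2 * (Real.pi : ℂ))⁻¹ * ∫ t : ℝ, G ((σ : ℂ) + t * Complex.I) =
        ((∫ ω, Real.log (1 + X ω) ∂P : ℝ) : ℂ) := by
  have hint := hX.integrable_prod h1 h0 (integrable_gamma_kernel h1 h0)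
  have hinner : ∀ t : ℝ, G ((σ : ℂ) + t * Complex.I) =
      ∫ ω, Complex.Gamma (-((σ : ℂ) + t * Complex.I)) *
        Complex.Gamma (1 + ((σ : ℂ) + t * Complex.I)) / (-((σ : ℂ) + t * Complex.I)) *
          (X ω : ℂ) ^ (-((σ : ℂ) + t * Complex.I)) ∂P := fun t => by
    rw [integral_const_mul, hX.integral_eq _ (by simpa using h1) (by simpa using h0),
      hG _ (by simp)]
  have hlog : (fun ω => (2 * (Real.pi : ℂ))⁻¹ * ∫ t : ℝ,
      Complex.Gamma (-((σ : ℂ) + t * Complex.I)) *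
        Complex.Gamma (1 + ((σ : ℂ) + t * Complex.I)) / (-((σ : ℂ) + t * Complex.I)) *
          (X ω : ℂ) ^ (-((σ : ℂ) + t * Complex.I))) =ᵐ[P]
      fun ω => (Real.log (1 + X ω) : ℂ) := by
    filter_upwards [hX.pos] with ω hω using integral_gamma_kernel_mul_cpow h1 h0 hω
  refine ⟨?_, ?_, ?_⟩
  · simpa using ((hint.integral_prod_left.const_mul _).congr hlog).re
  · simp only [hinner]
    exact hint.integral_prod_right
  · rw [← integral_complex_ofReal, ← integral_congr_ae hlog, integral_const_mul]
    simp only [hinner]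
    rw [← integral_integral_swap (f := fun ω t => _) hint]

/-! ### Moments of the gamma and inverse-gamma laws. -/

theorem ae_pos_withDensity {f : ℝ → ENNReal} (hf : Measurable f) (h : ∀ x < 0, f x = 0) :
    ∀ᵐ x ∂(volume.withDensity f), 0 < x := by
  rw [ae_withDensity_iff hf]
  filter_upwards [Measure.ae_ne volume (0 : ℝ)] with x hx hfx
  exact lt_of_le_of_ne (not_lt.1 fun hlt => hfx (h x hlt)) hx.symm

theorem integral_withDensity_ofReal_eq {f : ℝ → ℝ} (hf : Measurable f) (hf0 : ∀ x, 0 ≤ f x)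
    (hneg : ∀ x < 0, f x = 0) (g : ℝ → ℂ) :
    ∫ x, g x ∂(volume.withDensity fun x => ENNReal.ofReal (f x)) =
      ∫ x in Ioi (0 : ℝ), (f x : ℂ) * g x := by
  rw [integral_withDensity_eq_integral_toReal_smul hf.ennreal_ofReal (by simp)]
  simp only [ENNReal.toReal_ofReal (hf0 _), Complex.real_smul]
  rw [← integral_Ici_eq_integral_Ioi]
  refine (setIntegral_eq_integral_of_forall_compl_eq_zero fun x hx => ?_).symm
  simp [hneg x (by simpa using hx)]

theorem integral_gammaMeasure_cpow {a r : ℝ} (ha : 0 < a) (hr : 0 < r) {s : ℂ} (hs : s.re < a) :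
    ∫ x, (x : ℂ) ^ (-s) ∂(gammaMeasure a r) =
      (r : ℂ) ^ s * (Complex.Gamma (a - s) / Complex.Gamma a) := by
  have hr' : (r : ℂ) ≠ 0 := by exact_mod_cast hr.ne'
  unfold gammaMeasure gammaPDF
  rw [integral_withDensity_ofReal_eq (measurable_gammaPDFReal a r)
    (gammaPDFReal_nonneg ha hr) (fun x hx => by simp [gammaPDFReal, not_le.2 hx])]
  calc
    _ = ∫ x in Ioi (0 : ℝ), ((r : ℂ) ^ (a : ℂ) / Complex.Gamma a) *
          ((x : ℂ) ^ ((a : ℂ) - s - 1) * Complex.exp (-(r * x))) := by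
      refine setIntegral_congr_fun measurableSet_Ioi fun x hx => ?_
      have hx' : (0 : ℝ) < x := hx
      simp only [gammaPDFReal, if_pos hx'.le]
      rw [show (a : ℂ) - s - 1 = ((a : ℂ) - 1) + (-s) by ring,
        Complex.cpow_add _ _ (by exact_mod_cast hx'.ne')]
      push_cast [Complex.ofReal_cpow hr.le, Complex.ofReal_cpow hx'.le, Complex.Gamma_ofReal]
      ring
    _ = _ := by
      rw [integral_const_mul, Complex.integral_cpow_mul_exp_neg_mul_Ioi (by simpa using hs) hr,
        one_div, Complex.inv_cpow _ _ (by
          rw [Complex.arg_ofReal_of_nonneg hr.le]; exact Real.pi_pos.ne), ← Complex.cpow_neg,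
        show -((a : ℂ) - s) = -a + s by ring, Complex.cpow_add _ _ hr', Complex.cpow_neg]
      have : (r : ℂ) ^ (a : ℂ) ≠ 0 := by simp [Complex.cpow_eq_zero_iff, hr']
      field_simp

theorem measurable_invGammaPDFReal (α β : ℝ) : Measurable (invGammaPDFReal α β) := by
  unfold invGammaPDFReal
  exact Measurable.ite measurableSet_Ioi (by fun_prop) measurable_const

theorem invGammaPDFReal_nonneg {α β : ℝ} (hα : 0 < α) (hβ : 0 < β) (y : ℝ) :
    0 ≤ invGammaPDFReal α β y := by
  unfold invGammaPDFReal
  split_ifs <;> positivity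

theorem integral_invGammaMeasure_cpow {α β : ℝ} (hα : 0 < α) (hβ : 0 < β) {s : ℂ}
    (hs : -α < s.re) :
    ∫ x, (x : ℂ) ^ (-s) ∂(invGammaMeasure α β) =
      ((β : ℂ) ^ s)⁻¹ * (Complex.Gamma (α + s) / Complex.Gamma α) := by
  have hβ' : (β : ℂ) ≠ 0 := by exact_mod_cast hβ.ne'
  unfold invGammaMeasure
  rw [integral_withDensity_ofReal_eq (measurable_invGammaPDFReal α β)
    (invGammaPDFReal_nonneg hα hβ) (fun x hx => by simp [invGammaPDFReal, not_lt.2 hx.le])]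
  calc
    -- The substitution `u = x⁻¹`, with Jacobian `x ^ (-2)`, turns the integral into a gamma
    -- integral of exponent `α + s`.
    _ = ∫ x in Ioi (0 : ℝ), (|(-1 : ℝ)| * x ^ ((-1 : ℝ) - 1)) •
          (fun u : ℝ => ((β : ℂ) ^ (α : ℂ) / Complex.Gamma α) *
            ((u : ℂ) ^ ((α : ℂ) + s - 1) * Complex.exp (-(β * u)))) (x ^ (-1 : ℝ)) := by
      refine setIntegral_congr_fun measurableSet_Ioi fun x hx => ?_
      have hx' : (0 : ℝ) < x := hx
      have hxc : (x : ℂ) ≠ 0 := by exact_mod_cast hx'.ne'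
      have e : ((x⁻¹ : ℝ) : ℂ) ^ ((α : ℂ) + s - 1) =
          (x : ℂ) ^ (-s) / (x : ℂ) ^ ((α : ℂ) + 1) * (x : ℂ) ^ (2 : ℂ) := by
        rw [Complex.ofReal_inv, Complex.inv_cpow _ _ (by
          rw [Complex.arg_ofReal_of_nonneg hx'.le]; exact Real.pi_pos.ne), ← Complex.cpow_neg,
          ← Complex.cpow_sub _ _ hxc, ← Complex.cpow_add _ _ hxc]
        ring_nf
      have e2 : (x ^ ((-1 : ℝ) - 1)) = (x ^ 2)⁻¹ := by
        rw [show (-1 : ℝ) - 1 = -(2 : ℕ) by norm_num, Real.rpow_neg hx'.le, Real.rpow_natCast]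
      simp only [invGammaPDFReal, if_pos hx', Real.rpow_neg_one, e, e2, Complex.real_smul]
      push_cast [Complex.ofReal_cpow hβ.le, Complex.ofReal_cpow hx'.le, Complex.Gamma_ofReal]
      rw [Complex.cpow_ofNat]
      field_simp
      simp
    _ = ∫ u in Ioi (0 : ℝ), ((β : ℂ) ^ (α : ℂ) / Complex.Gamma α) *
          ((u : ℂ) ^ ((α : ℂ) + s - 1) * Complex.exp (-(β * u))) :=
      integral_comp_rpow_Ioi (fun u : ℝ => ((β : ℂ) ^ (α : ℂ) / Complex.Gamma α) *
        ((u : ℂ) ^ ((α : ℂ) + s - 1) * Complex.exp (-(β * u)))) (by norm_num : (-1 : ℝ) ≠ 0)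
    _ = _ := by
      rw [integral_const_mul,
        Complex.integral_cpow_mul_exp_neg_mul_Ioi (by simpa using by linarith) hβ,
        one_div, Complex.inv_cpow _ _ (by
          rw [Complex.arg_ofReal_of_nonneg hβ.le]; exact Real.pi_pos.ne),
        Complex.cpow_add _ _ hβ', mul_inv]
      have : (β : ℂ) ^ (α : ℂ) ≠ 0 := by simp [Complex.cpow_eq_zero_iff, hβ']
      field_simp

theorem ofReal_cpow_ne_zero {x : ℝ} (hx : 0 < x) (s : ℂ) : (x : ℂ) ^ s ≠ 0 := by
  simp [Complex.cpow_eq_zero_iff, hx.ne']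

theorem hasMellinMoment_nakagamiSq {X : S → ℝ} {m Ω : ℝ} (hm : 0 < m) (hΩ : 0 < Ω)
    (hX : HasLaw X (nakagamiSqMeasure m Ω) P) :
    HasMellinMoment P X fun s =>
      ((m / Ω : ℝ) : ℂ) ^ s * (Complex.Gamma (m - s) / Complex.Gamma m) where
  aemeasurable := hX.aemeasurable
  pos := by
    refine ae_of_ae_map hX.aemeasurable (p := fun x => 0 < x) ?_
    rw [hX.map_eq]
    exact ae_pos_withDensity (measurable_gammaPDFReal _ _).ennreal_ofReal
      fun x hx => gammaPDF_of_neg hx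
  integral_eq s _ h0 := by
    rw [← integral_gammaMeasure_cpow hm (div_pos hm hΩ) (h0.trans hm)]
    exact hX.integral_comp (f := fun x : ℝ => (x : ℂ) ^ (-s))
      (Measurable.aestronglyMeasurable (by fun_prop))
  ne_zero s _ h0 := mul_ne_zero (ofReal_cpow_ne_zero (div_pos hm hΩ) s) <| div_ne_zero
    (Complex.Gamma_ne_zero_of_re_pos (by simpa using h0.trans hm))
    (Complex.Gamma_ne_zero_of_re_pos (by simpa using hm))

/-- The bound `α > 1` keeps `Re (α + s)` positive on the whole strip. -/
theorem hasMellinMoment_invGamma {X : S → ℝ} {α β : ℝ} (hα : 1 < α) (hβ : 0 < β)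
    (hX : HasLaw X (invGammaMeasure α β) P) :
    HasMellinMoment P X fun s =>
      ((β : ℂ) ^ s)⁻¹ * (Complex.Gamma (α + s) / Complex.Gamma α) where
  aemeasurable := hX.aemeasurable
  pos := by
    refine ae_of_ae_map hX.aemeasurable (p := fun x => 0 < x) ?_
    rw [hX.map_eq]
    exact ae_pos_withDensity (measurable_invGammaPDFReal _ _).ennreal_ofReal
      fun x hx => by simp [invGammaPDFReal, not_lt.2 hx.le]
  integral_eq s h1 _ := by
    rw [← integral_invGammaMeasure_cpow (by linarith) hβ (by linarith)]
    exact hX.integral_comp (f := fun x : ℝ => (x : ℂ) ^ (-s))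
      (Measurable.aestronglyMeasurable (by fun_prop))
  ne_zero s h1 _ := mul_ne_zero (inv_ne_zero (ofReal_cpow_ne_zero hβ s)) <| div_ne_zero
    (Complex.Gamma_ne_zero_of_re_pos (by simpa using by linarith))
    (Complex.Gamma_ne_zero_of_re_pos (by simpa using by linarith))

/-! ### From moments to the G-function. -/

/-- If the Mellin-Barnes integrand is `C⁻¹` times the Mellin kernel of `log (1 + x)` times the
Mellin moment of `X`, then the G-function is `C⁻¹ * E[log (1 + X)]`. -/
theorem HasMellinMoment.capacity [SFinite P] {X : S → ℝ} {M : ℂ → ℂ} (hX : HasMellinMoment P X M)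
    {p q m n : ℕ} {a : Fin p → ℂ} {b : Fin q → ℂ} {z : ℂ} {C : ℝ} (hC : C ≠ 0)
    (hsep : ∀ σ, SeparatesPoles m n a b σ ↔ -1 < σ ∧ σ < 0)
    (hG : ∀ s : ℂ, -1 < s.re → s.re < 0 → C * meijerGIntegrand m n a b z s =
      Complex.Gamma (-s) * Complex.Gamma (1 + s) / (-s) * M s) (BW : ℝ) :
    Integrable (fun ω => Real.logb 2 (1 + X ω)) P ∧ MeijerGWellDefined m n a b z ∧
      ((ergodicCapacity P BW X : ℝ) : ℂ) =
        (BW : ℂ) * (C : ℂ) * ((Real.log 2 : ℝ) : ℂ)⁻¹ * meijerG m n a b z := by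
  have hC' : (C : ℂ) ≠ 0 := by exact_mod_cast hC
  have hσ (σ : ℝ) (h : SeparatesPoles m n a b σ) :=
    hX.log_one_add ((hsep σ).1 h).1 ((hsep σ).1 h).2 (G := fun s => C * meijerGIntegrand m n a b z s)
      fun s hs => hG s (hs ▸ ((hsep σ).1 h).1) (hs ▸ ((hsep σ).1 h).2)
  -- The right-hand side does not involve `σ`: this is the independence of the line.
  have hline (σ : ℝ) (h : SeparatesPoles m n a b σ) :
      meijerGLine m n a b z σ = (C : ℂ)⁻¹ * ((∫ ω, Real.log (1 + X ω) ∂P : ℝ) : ℂ) := by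
    rw [← (hσ σ h).2.2, integral_const_mul, meijerGLine]
    rw [mul_left_comm _ (C : ℂ), inv_mul_cancel_left₀ hC']
  have hex : ∃ σ, SeparatesPoles m n a b σ := ⟨-1 / 2, (hsep _).2 (by norm_num)⟩
  have hval : meijerG m n a b z = (C : ℂ)⁻¹ * ((∫ ω, Real.log (1 + X ω) ∂P : ℝ) : ℂ) := by
    rw [meijerG, dif_pos hex]
    exact hline _ hex.choose_spec
  refine ⟨?_, ⟨hex, fun σ h => ⟨?_, (hline σ h).trans hval.symm⟩⟩, ?_⟩
  · obtain ⟨σ, h⟩ := hex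
    exact (hσ σ h).1.div_const _
  · simpa [hC'] using (hσ σ h).2.1.const_mul (C : ℂ)⁻¹
  · rw [hval, ergodicCapacity]
    simp only [Real.logb]
    rw [integral_div]
    push_cast
    field_simp

theorem ofReal_div_cpow {x y : ℝ} (hx : 0 < x) (hy : 0 < y) (s : ℂ) :
    ((x / y : ℝ) : ℂ) ^ s = (x : ℂ) ^ s * ((y : ℂ) ^ s)⁻¹ := by
  rw [div_eq_mul_inv, Complex.ofReal_mul, Complex.mul_cpow_ofReal_nonneg hx.le (inv_pos.2 hy).le,
    Complex.ofReal_inv, Complex.inv_cpow _ _ (by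
      rw [Complex.arg_ofReal_of_nonneg hy.le]; exact Real.pi_pos.ne)]

theorem ofReal_mul_cpow {x y : ℝ} (hx : 0 < x) (hy : 0 < y) (s : ℂ) :
    ((x * y : ℝ) : ℂ) ^ s = (x : ℂ) ^ s * (y : ℂ) ^ s := by
  rw [Complex.ofReal_mul, Complex.mul_cpow_ofReal_nonneg hx.le hy.le]

theorem Gamma_one_sub_eq {s : ℂ} (h0 : s.re < 0) :
    Complex.Gamma (1 - s) = -s * Complex.Gamma (-s) := by
  rw [← Complex.Gamma_add_one _ (neg_ne_zero.2 (by rintro rfl; simp at h0)), neg_add_eq_sub]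

/-- The lower parameters `0` force `σ < 0` and the upper parameter `0` forces `-1 < σ`; positivity
of `m_j` and `α_j > 1` make the other constraints weaker. -/
theorem separatesPoles_double {m₁ m₂ α₁ α₂ : ℝ} (hm₁ : 0 < m₁) (hm₂ : 0 < m₂) (hα₁ : 1 < α₁)
    (hα₂ : 1 < α₂) (σ : ℝ) :
    SeparatesPoles 4 3 ![1 - (α₂ : ℂ), 1 - (α₁ : ℂ), 0, 1] ![(m₁ : ℂ), (m₂ : ℂ), 0, 0] σ ↔
      -1 < σ ∧ σ < 0 := by
  simp [SeparatesPoles, Fin.forall_fin_succ]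
  grind

theorem separatesPoles_single {m₁ m₂ α : ℝ} (hm₁ : 0 < m₁) (hm₂ : 0 < m₂) (hα : 1 < α) (σ : ℝ) :
    SeparatesPoles 4 2 ![1 - (α : ℂ), 0, 1] ![(m₁ : ℂ), (m₂ : ℂ), 0, 0] σ ↔
      -1 < σ ∧ σ < 0 := by
  simp [SeparatesPoles, Fin.forall_fin_succ]
  grind

/-- The two lower zeros give `Γ(-s) ^ 2`; the upper `1` puts `Γ(1 - s)` in the denominator,
cancelling one factor and leaving `1 / (-s)`. -/
theorem meijerGIntegrand_double (m₁ m₂ α₁ α₂ z : ℝ) {s : ℂ} (h0 : s.re < 0) :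
    meijerGIntegrand 4 3 ![1 - (α₂ : ℂ), 1 - (α₁ : ℂ), 0, 1] ![(m₁ : ℂ), (m₂ : ℂ), 0, 0] z s =
      Complex.Gamma (-s) * Complex.Gamma (1 + s) / (-s) *
        (Complex.Gamma (m₁ - s) * Complex.Gamma (m₂ - s) * Complex.Gamma (α₁ + s) *
          Complex.Gamma (α₂ + s) * (z : ℂ) ^ s) := by
  have hΓ : Complex.Gamma (-s) ≠ 0 := Complex.Gamma_ne_zero_of_re_pos (by simpa using h0)
  have hs : s ≠ 0 := by rintro rfl; simp at h0
  simp [meijerGIntegrand, Fin.prod_univ_succ, Gamma_one_sub_eq h0]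
  field_simp

theorem meijerGIntegrand_single (m₁ m₂ α z : ℝ) {s : ℂ} (h0 : s.re < 0) :
    meijerGIntegrand 4 2 ![1 - (α : ℂ), 0, 1] ![(m₁ : ℂ), (m₂ : ℂ), 0, 0] z s =
      Complex.Gamma (-s) * Complex.Gamma (1 + s) / (-s) *
        (Complex.Gamma (m₁ - s) * Complex.Gamma (m₂ - s) * Complex.Gamma (α + s) *
          (z : ℂ) ^ s) := by
  have hΓ : Complex.Gamma (-s) ≠ 0 := Complex.Gamma_ne_zero_of_re_pos (by simpa using h0)
  have hs : s ≠ 0 := by rintro rfl; simp at h0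
  simp [meijerGIntegrand, Fin.prod_univ_succ, Gamma_one_sub_eq h0]
  field_simp

end ShadowedDoubleScattering

theorem mainTheorem6 {S : Type*} [MeasurableSpace S] (P : MeasureTheory.Measure S)
    [MeasureTheory.IsProbabilityMeasure P]
    (BW m₁ m₂ Ω : ℝ) (hm₁ : 0 < m₁) (hm₂ : 0 < m₂) (hΩ : 0 < Ω) :
    -- double shadowing
    (∀ (N₁ N₂ I₁ I₂ : S → ℝ) (α₁ α₂ β₁ β₂ γbar γtilde : ℝ),
      1 < α₁ → 1 < α₂ → 0 < β₁ → 0 < β₂ →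
      ShadowedDoubleScattering.IsDoubleShadowing P N₁ N₂ I₁ I₂ m₁ m₂ Ω α₁ α₂ β₁ β₂ →
      γbar = Ω ^ 2 * (β₁ * β₂) → γtilde = m₁ * m₂ / γbar →
      MeasureTheory.Integrable (fun ω =>
          Real.logb 2 (1 + ShadowedDoubleScattering.snrDS N₁ N₂ I₁ I₂ ω)) P ∧
        ShadowedDoubleScattering.MeijerGWellDefined 4 3
          ![1 - (α₂ : ℂ), 1 - (α₁ : ℂ), 0, 1] ![(m₁ : ℂ), (m₂ : ℂ), 0, 0] (γtilde : ℂ) ∧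
        ((ShadowedDoubleScattering.ergodicCapacity P BW
            (ShadowedDoubleScattering.snrDS N₁ N₂ I₁ I₂) : ℝ) : ℂ) =
          (BW : ℂ) * (ShadowedDoubleScattering.constDS m₁ m₂ α₁ α₂ : ℂ) *
            ((Real.log 2 : ℝ) : ℂ)⁻¹ *
            ShadowedDoubleScattering.meijerG 4 3
              ![1 - (α₂ : ℂ), 1 - (α₁ : ℂ), 0, 1] ![(m₁ : ℂ), (m₂ : ℂ), 0, 0] (γtilde : ℂ)) ∧
    -- single shadowing
    (∀ (N₁ N₂ I : S → ℝ) (α β γbar γtilde : ℝ),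
      1 < α → 0 < β →
      ShadowedDoubleScattering.IsSingleShadowing P N₁ N₂ I m₁ m₂ Ω α β →
      γbar = Ω ^ 2 * β → γtilde = m₁ * m₂ / γbar →
      MeasureTheory.Integrable (fun ω =>
          Real.logb 2 (1 + ShadowedDoubleScattering.snrSS N₁ N₂ I ω)) P ∧
        ShadowedDoubleScattering.MeijerGWellDefined 4 2
          ![1 - (α : ℂ), 0, 1] ![(m₁ : ℂ), (m₂ : ℂ), 0, 0] (γtilde : ℂ) ∧
        ((ShadowedDoubleScattering.ergodicCapacity P BW
            (ShadowedDoubleScattering.snrSS N₁ N₂ I) : ℝ) : ℂ) =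
          (BW : ℂ) * (ShadowedDoubleScattering.constSS m₁ m₂ α : ℂ) *
            ((Real.log 2 : ℝ) : ℂ)⁻¹ *
            ShadowedDoubleScattering.meijerG 4 2
              ![1 - (α : ℂ), 0, 1] ![(m₁ : ℂ), (m₂ : ℂ), 0, 0] (γtilde : ℂ)) := by

  constructor
  · rintro N₁ N₂ I₁ I₂ α₁ α₂ β₁ β₂ γbar γtilde hα₁ hα₂ hβ₁ hβ₂ h rfl rfl
    have hX := ((ShadowedDoubleScattering.hasMellinMoment_nakagamiSq hm₁ hΩ h.law_N₁).mul
      (ShadowedDoubleScattering.hasMellinMoment_invGamma hα₁ hβ₁ h.law_I₁) h.indep₁).mul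
      ((ShadowedDoubleScattering.hasMellinMoment_nakagamiSq hm₂ hΩ h.law_N₂).mul
      (ShadowedDoubleScattering.hasMellinMoment_invGamma hα₂ hβ₂ h.law_I₂) h.indep₂) h.indep
    refine hX.capacity ?_
      (ShadowedDoubleScattering.separatesPoles_double hm₁ hm₂ hα₁ hα₂) (fun s _ h0 => ?_) BW
    · have := Real.Gamma_pos_of_pos (zero_lt_one.trans hα₁)
      have := Real.Gamma_pos_of_pos (zero_lt_one.trans hα₂)
      have := Real.Gamma_pos_of_pos hm₁
      have := Real.Gamma_pos_of_pos hm₂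
      unfold ShadowedDoubleScattering.constDS
      positivity
    · rw [ShadowedDoubleScattering.meijerGIntegrand_double _ _ _ _ _ h0,
        -- The rates `m_j / Ω` and the scales `β_j` are separated, to match the powers in the
        -- moments.
        show m₁ * m₂ / (Ω ^ 2 * (β₁ * β₂)) = m₁ / Ω * (m₂ / Ω) / (β₁ * β₂) by field_simp,
        ShadowedDoubleScattering.ofReal_div_cpow (by positivity) (by positivity),
        ShadowedDoubleScattering.ofReal_mul_cpow (by positivity) (by positivity),
        ShadowedDoubleScattering.ofReal_mul_cpow hβ₁ hβ₂, ShadowedDoubleScattering.constDS]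
      push_cast [Complex.Gamma_ofReal]
      ring
  · rintro N₁ N₂ I α β γbar γtilde hα hβ h rfl rfl
    have hN := (ShadowedDoubleScattering.hasMellinMoment_nakagamiSq hm₁ hΩ h.law_N₁).mul
      (ShadowedDoubleScattering.hasMellinMoment_nakagamiSq hm₂ hΩ h.law_N₂) h.indep_N
    -- The product of squares becomes `(N₁ N₂) ^ 2`, the variable assumed independent of `I`.
    simp only [← mul_pow] at hN
    have hX := hN.mul (ShadowedDoubleScattering.hasMellinMoment_invGamma hα hβ h.law_I) h.indep
    refine hX.capacity ?_
      (ShadowedDoubleScattering.separatesPoles_single hm₁ hm₂ hα) (fun s _ h0 => ?_) BW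
    · have := Real.Gamma_pos_of_pos (zero_lt_one.trans hα)
      have := Real.Gamma_pos_of_pos hm₁
      have := Real.Gamma_pos_of_pos hm₂
      unfold ShadowedDoubleScattering.constSS
      positivity
    · rw [ShadowedDoubleScattering.meijerGIntegrand_single _ _ _ _ h0,
        show m₁ * m₂ / (Ω ^ 2 * β) = m₁ / Ω * (m₂ / Ω) / β by field_simp,
        ShadowedDoubleScattering.ofReal_div_cpow (by positivity) hβ,
        ShadowedDoubleScattering.ofReal_mul_cpow (by positivity) (by positivity),
        ShadowedDoubleScattering.constSS]
      push_cast [Complex.Gamma_ofReal]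
      ring
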